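/- Let $(X_i)_{i\ge 1}$ be i.i.d. Poisson random variables of parameter $1$, let $S_m=\sum_{i=1}^m (X_i-1)$ for $m\ge 0$, and let $\tau_{-1}=\min\{m\ge 1: S_m=-1\}$. For $n \ge 2$ let $\mathbb{E}_n=\mathbb{E}[\,\cdot\mid \tau_{-1}=n+1]$ be the expectation conditional on the event $\{\tau_{-1}=n+1\}$, which has positive probability. There exists a constant $C>0$ such that for all integers $n\ge 2$ and $1\le k\le n-1$ and all real $d\ge 1$ the moment $\mathbb{E}_n[S_k^d]$ is finite and (i) $\mathbb{E}_n[S_k^d]\le (Cdn)^{d/2}$; (ii) $\mathbb{E}_n[S_{n-k}^d]\le \left(\frac{n}{n-k}\right)^{3/2}(Cdk)^{d/2}$; (iii) $\mathbb{E}_n[S_k^d]\le \left(\frac{n}{n-k}\right)^{3/2}(Cd\sqrt{k})^d$. -/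

import Mathlib

open MeasureTheory ProbabilityTheory

/-- The walk `S_n = ∑_{i=1}^n (X_i - 1)`; the variable `X_i` of the sequence `(X_i)_{i ≥ 1}` is
`X (i - 1)` here. -/
def walk {Ω : Type*} (X : ℕ → Ω → ℕ) (n : ℕ) (ω : Ω) : ℤ :=
  ∑ i ∈ Finset.range n, ((X i ω : ℤ) - 1)

/-- `τ_a = min {n ≥ 1 : S_n = a}`, with value `⊤` if `a` is never reached. -/
noncomputable def hitTime {Ω : Type*} (X : ℕ → Ω → ℕ) (a : ℤ) : Ω → WithTop ℕ :=
  hittingAfter (walk X) {a} 1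

/-- The event `{τ_{-1} = n + 1}` that the walk makes an excursion of length `n + 1`. -/
def excursion {Ω : Type*} (X : ℕ → Ω → ℕ) (n : ℕ) : Set Ω :=
  {ω | hitTime X (-1) ω = ((n + 1 : ℕ) : WithTop ℕ)}

/-- The conditional probability `ℙ_n = ℙ(· | τ_{-1} = n + 1)`. -/
noncomputable def excursionMeasure {Ω : Type*} [MeasurableSpace Ω] (P : Measure Ω)
    (X : ℕ → Ω → ℕ) (n : ℕ) : Measure Ω :=
  ProbabilityTheory.cond P (excursion X n)

/-- The moment `E_n[S_k ^ d]` of order `d` under the conditional probability `ℙ_n`. -/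
noncomputable def excursionMoment {Ω : Type*} [MeasurableSpace Ω] (P : Measure Ω)
    (X : ℕ → Ω → ℕ) (n k : ℕ) (d : ℝ) : ℝ :=
  ∫ ω, (walk X k ω : ℝ) ^ d ∂(excursionMeasure P X n)

/-!
By the Markov property at time `k` and Kemperman's formula
`P(τ_{-y} = m) = y / m * P(S_m = -y) = q_m(y)`, the moment `E_n[S_k ^ d]` is the sum of
`x ^ d * P(S_k = x, τ_{-1} > k) * q_{n+1-k}(x + 1)` over `x`, divided by `q_{n+1}(1)`.

For (i) and (ii), put `m = n + 1 - k`. Then `q_m(x + 1) ≤ 8 e^{-x² / 4m} q_{4m}(x + 1)`, the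
Gaussian factor turns `x ^ d` into a multiple of `(d m) ^ (d / 2)`, and what remains is at most the
probability `q_{k+4m}(1) ≤ q_{n+1}(1)` of a longer excursion.

For (iii), `q_m(x + 1)` is at most `x + 1` times a multiple of `q_{n+1}(1)`, and it remains to bound
an exponential moment of the walk killed at `-1`. The function `e^{sz} - e^{-2sz}` of `z = x + 1` is
multiplied by at most `e^{s²}` at each step and is of order `s` at the start, so that `s = 1 / √k`
balances the growth over `k` steps.
-/

namespace PoissonExcursion

open Finset
open scoped Nat

section Elementary

lemma sum_range_cast_div (m y : ℕ) :
    ∑ i ∈ range y, (i / m : ℝ) = y * (y - 1) / (2 * m) := by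
  induction y with
  | zero => simp
  | succ y ih =>
    rw [sum_range_succ, ih]
    push_cast
    ring

lemma sum_range_sum_antidiagonal_succ_le {f : ℕ × ℕ → ℝ} (hf : ∀ ij, 0 ≤ f ij) (N : ℕ) :
    ∑ x ∈ range N, ∑ ij ∈ antidiagonal (x + 1), f ij
      ≤ ∑ i ∈ range (N + 1), ∑ j ∈ range (N + 1), f (i, j) := by
  have hdisj : (range N : Set ℕ).PairwiseDisjoint fun x => antidiagonal (x + 1) :=
    fun x _ y _ hxy => disjoint_left.2 fun ij hx hy => by
      rw [HasAntidiagonal.mem_antidiagonal] at hx hy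
      omega
  rw [← sum_product', ← sum_biUnion hdisj]
  refine sum_le_sum_of_subset_of_nonneg (fun ij hij => ?_) fun ij _ _ => hf ij
  obtain ⟨x, hx, hij⟩ := mem_biUnion.1 hij
  rw [HasAntidiagonal.mem_antidiagonal] at hij
  rw [mem_range] at hx
  exact mem_product.2 ⟨mem_range.2 (by omega), mem_range.2 (by omega)⟩

lemma exp_neg_two_mul_le_one_sub {t : ℝ} (h0 : 0 ≤ t) (ht : t ≤ 1 / 2) :
    Real.exp (-(2 * t)) ≤ 1 - t := by
  rw [Real.exp_neg]
  refine inv_le_of_inv_le₀ (by linarith) ?_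
  calc (1 - t)⁻¹ ≤ 2 * t + 1 := by
        rw [inv_le_iff_one_le_mul₀ (by linarith)]
        nlinarith
    _ ≤ Real.exp (2 * t) := Real.add_one_le_exp _

lemma rpow_le_mul_exp {t p c : ℝ} (ht : 0 ≤ t) (hp : 0 < p) (hc : 0 < c) :
    t ^ p ≤ (p / c) ^ p * Real.exp (c * t) := by
  have hbase : c * t / p ≤ Real.exp (c * t / p) := by
    linarith [Real.add_one_le_exp (c * t / p)]
  calc t ^ p = (p / c) ^ p * (c * t / p) ^ p := by
        rw [← Real.mul_rpow (by positivity) (by positivity)]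
        congr 1
        field_simp
    _ ≤ (p / c) ^ p * Real.exp (c * t / p) ^ p := by gcongr
    _ = (p / c) ^ p * Real.exp (c * t) := by rw [← Real.exp_mul, div_mul_cancel₀ _ hp.ne']

lemma rpow_le_mul_exp_sq {x d c : ℝ} (hx : 0 ≤ x) (hd : 0 < d) (hc : 0 < c) :
    x ^ d ≤ (d / (2 * c)) ^ (d / 2) * Real.exp (c * x ^ 2) := by
  have h := rpow_le_mul_exp (sq_nonneg x) (half_pos hd) hc
  rwa [← Real.rpow_natCast_mul hx, Nat.cast_ofNat, mul_div_cancel₀ _ two_ne_zero, div_div] at h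

lemma mul_rpow_le {a x d : ℝ} (ha : 1 ≤ a) (hx : 0 ≤ x) (hd : 1 ≤ d) :
    a * x ^ d ≤ (a * x) ^ d := by
  rw [Real.mul_rpow (by positivity) hx]
  gcongr
  exact Real.self_le_rpow_of_one_le ha hd

lemma mul_rpow_half_le {a x d : ℝ} (ha : 1 ≤ a) (hx : 0 ≤ x) (hd : 1 ≤ d) :
    a * x ^ (d / 2) ≤ (a ^ 2 * x) ^ (d / 2) := by
  have h := mul_rpow_le ha (Real.sqrt_nonneg x) hd
  rwa [← Real.sqrt_sq (zero_le_one.trans ha), ← Real.sqrt_mul (sq_nonneg a),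
    Real.sqrt_sq (zero_le_one.trans ha), Real.sqrt_eq_rpow, Real.sqrt_eq_rpow, ← Real.rpow_mul hx,
    ← Real.rpow_mul (by positivity), one_div_mul_eq_div] at h

lemma exp_sub_exp_neg_two_mul_le {s : ℝ} (h0 : 0 ≤ s) (h1 : s ≤ 1) :
    Real.exp s - Real.exp (-(2 * s)) ≤ 3 * s := by
  have hexp := (abs_le.1 (Real.abs_exp_sub_one_sub_id_le (abs_le.2 ⟨by linarith, h1⟩))).2
  have hsq : Real.exp (-(2 * s)) = Real.exp (-s) ^ 2 := by
    rw [← Real.exp_nat_mul]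
    push_cast
    ring_nf
  have hneg := Real.one_sub_le_exp_neg s
  nlinarith

end Elementary

section Measure

variable {Ω : Type*} [MeasurableSpace Ω] {P : Measure Ω}

lemma hasSum_measureReal_inter_preimage [IsFiniteMeasure P] {f : Ω → ℕ} (hf : Measurable f)
    (S : Set Ω) : HasSum (fun i => P.real (S ∩ f ⁻¹' {i})) (P.real S) := by
  have hfiber : ∀ i, MeasurableSet (f ⁻¹' {i}) := fun i => hf (measurableSet_singleton i)
  have htsum : ∑' i, P (S ∩ f ⁻¹' {i}) = P S := by
    calc ∑' i, P (S ∩ f ⁻¹' {i}) = ∑' i, P.restrict S (f ⁻¹' {i}) := by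
          simp only [Measure.restrict_apply (hfiber _), Set.inter_comm]
      _ = P.restrict S (⋃ i, f ⁻¹' {i}) :=
          (measure_iUnion (fun i j hij => Disjoint.preimage f (by simpa using hij)) hfiber).symm
      _ = P S := by
          rw [← Set.preimage_iUnion, Set.iUnion_of_singleton, Set.preimage_univ,
            Measure.restrict_apply_univ]
  have hsum := ENNReal.hasSum_toReal (htsum.symm ▸ measure_ne_top P S)
  rwa [← ENNReal.tsum_toReal_eq fun i => measure_ne_top P _, htsum] at hsum

section FiniteRange

variable {α : Type*} [MeasurableSpace α] [MeasurableSingletonClass α] {f : Ω → α} {s : Finset α}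

lemma map_restrict_of_ae_mem_finset (hf : Measurable f) (hs : ∀ᵐ ω ∂P, f ω ∈ s) :
    (P.map f).restrict s = P.map f :=
  Measure.restrict_eq_self_of_ae_mem ((ae_map_iff hf.aemeasurable s.measurableSet).2 hs)

variable [IsFiniteMeasure P]

lemma integrable_map_of_ae_mem_finset (hf : Measurable f) (hs : ∀ᵐ ω ∂P, f ω ∈ s) (g : α → ℝ) :
    Integrable g (P.map f) := by
  rw [← map_restrict_of_ae_mem_finset hf hs]
  exact IntegrableOn.finset

lemma integral_comp_of_ae_mem_finset (hf : Measurable f) (hs : ∀ᵐ ω ∂P, f ω ∈ s) (g : α → ℝ) :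
    ∫ ω, g (f ω) ∂P = ∑ x ∈ s, P.real (f ⁻¹' {x}) * g x := by
  rw [← integral_map hf.aemeasurable
      (integrable_map_of_ae_mem_finset hf hs g).aestronglyMeasurable,
    ← map_restrict_of_ae_mem_finset hf hs, setIntegral_finset s IntegrableOn.finset]
  simp only [map_measureReal_apply hf (measurableSet_singleton _), smul_eq_mul]

end FiniteRange

end Measure

section PoissonWeight

/-- The weight `e^{-r} r ^ n / n!` that the Poisson law of parameter `r` gives to `n`. It is a
function of a real `r`, so that parameters can be added and compared without coercions. -/
noncomputable def poissonWeight (r : ℝ) (n : ℕ) : ℝ := Real.exp (-r) * r ^ n / n !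

lemma poissonWeight_nonneg {r : ℝ} (hr : 0 ≤ r) (n : ℕ) : 0 ≤ poissonWeight r n := by
  unfold poissonWeight; positivity

lemma succ_mul_poissonWeight_succ (r : ℝ) (n : ℕ) :
    (n + 1) * poissonWeight r (n + 1) = r * poissonWeight r n := by
  simp only [poissonWeight, Nat.factorial_succ, Nat.cast_mul, Nat.cast_succ]
  field_simp
  ring

lemma hasSum_poissonWeight_mul_pow (r t : ℝ) :
    HasSum (fun n => poissonWeight r n * t ^ n) (Real.exp (r * (t - 1))) := by
  have h := (NormedSpace.expSeries_div_hasSum_exp (r * t)).mul_left (Real.exp (-r))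
  rw [← Real.exp_eq_exp_ℝ, ← Real.exp_add, show -r + r * t = r * (t - 1) by ring] at h
  refine h.congr_fun fun n => ?_
  rw [poissonWeight, mul_pow]
  ring

lemma sum_antidiagonal_poissonWeight_mul (a b : ℝ) (N : ℕ) :
    ∑ ij ∈ antidiagonal N, poissonWeight a ij.1 * poissonWeight b ij.2
      = poissonWeight (a + b) N := by
  rw [poissonWeight, (Commute.all a b).add_pow', neg_add, Real.exp_add, mul_sum, sum_div]
  refine sum_congr rfl fun ij hij => ?_
  rw [← mem_antidiagonal.1 hij, nsmul_eq_mul, Nat.cast_add_choose, poissonWeight, poissonWeight]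
  field_simp

lemma add_mul_sum_antidiagonal_poissonWeight_mul (a b : ℝ) (N : ℕ) :
    (a + b) * ∑ ij ∈ antidiagonal N, poissonWeight a ij.1 * (ij.2 * poissonWeight b ij.2)
      = b * (N * poissonWeight (a + b) N) := by
  cases N with
  | zero => simp
  | succ N =>
    have hshift : ∀ ij : ℕ × ℕ, poissonWeight a ij.1 * ((ij.2 + 1 : ℕ) * poissonWeight b (ij.2 + 1))
        = b * (poissonWeight a ij.1 * poissonWeight b ij.2) := fun ij => by
      rw [Nat.cast_succ, succ_mul_poissonWeight_succ]
      ring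
    rw [Nat.sum_antidiagonal_succ', sum_congr rfl fun ij _ => hshift ij, ← mul_sum,
      sum_antidiagonal_poissonWeight_mul, Nat.cast_succ, succ_mul_poissonWeight_succ]
    simp only [Nat.cast_zero, zero_mul, mul_zero, zero_add]
    ring

lemma poissonWeight_sub {m y : ℕ} (hy : y ≤ m) :
    poissonWeight m (m - y) = poissonWeight m m * ∏ i ∈ range y, (1 - i / m : ℝ) := by
  induction y with
  | zero => simp
  | succ y ih =>
    have hm : (m : ℝ) ≠ 0 := by norm_cast; omega
    have hsucc := succ_mul_poissonWeight_succ m (m - (y + 1))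
    rw [show m - (y + 1) + 1 = m - y by omega, ih (by omega), Nat.cast_sub hy] at hsucc
    push_cast at hsucc
    rw [prod_range_succ, ← mul_right_inj' hm, ← hsucc]
    field_simp
    ring

lemma poissonWeight_sub_le {m y : ℕ} (hy : y ≤ m) :
    poissonWeight m (m - y) ≤ poissonWeight m m * Real.exp (-(y * (y - 1) / (2 * m))) := by
  rw [poissonWeight_sub hy, ← sum_range_cast_div, ← sum_neg_distrib, Real.exp_sum]
  gcongr with i
  · exact poissonWeight_nonneg (Nat.cast_nonneg m) m
  · intro i hi
    rw [sub_nonneg]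
    exact div_le_one_of_le₀ (by exact_mod_cast (mem_range.1 hi).le.trans hy) (Nat.cast_nonneg m)
  · exact Real.one_sub_le_exp_neg _

lemma le_poissonWeight_sub {m y : ℕ} (hy : 2 * y ≤ m) :
    poissonWeight m m * Real.exp (-(y * (y - 1) / m)) ≤ poissonWeight m (m - y) := by
  have hsum : (y * (y - 1) / m : ℝ) = ∑ i ∈ range y, 2 * (i / m : ℝ) := by
    rw [← mul_sum, sum_range_cast_div]
    ring
  rw [poissonWeight_sub (by omega), hsum, ← sum_neg_distrib, Real.exp_sum]
  gcongr with i hi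
  · exact poissonWeight_nonneg (Nat.cast_nonneg m) m
  · have hi : 2 * i ≤ m := by linarith [mem_range.1 hi]
    have hi : (2 * i : ℝ) ≤ m := by exact_mod_cast hi
    exact exp_neg_two_mul_le_one_sub (by positivity)
      (div_le_of_le_mul₀ (by positivity) (by norm_num) (by linarith))

lemma sqrt_mul_poissonWeight_self (m : ℕ) :
    √(m + 1 : ℝ) * poissonWeight (m + 1) (m + 1) = (√2 * Stirling.stirlingSeq (m + 1))⁻¹ := by
  simp only [poissonWeight, Stirling.stirlingSeq, Nat.cast_succ]
  rw [Real.sqrt_mul zero_le_two, div_pow, ← Real.exp_nat_mul, Real.exp_neg, Nat.cast_succ, mul_one]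
  field_simp

lemma poissonWeight_self_le_sqrt_mul {m N : ℕ} (hm : 1 ≤ m) (hN : m ≤ N) :
    poissonWeight m m ≤ √(N / m : ℝ) * poissonWeight N N := by
  obtain ⟨m, rfl⟩ := Nat.exists_eq_add_of_le' hm
  obtain ⟨N, rfl⟩ := Nat.exists_eq_add_of_le' (hm.trans hN)
  have hanti : Stirling.stirlingSeq (N + 1) ≤ Stirling.stirlingSeq (m + 1) :=
    Stirling.stirlingSeq'_antitone (by omega)
  have hpos := Stirling.stirlingSeq'_pos N
  have h : √(m + 1 : ℝ) * poissonWeight (m + 1) (m + 1)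
      ≤ √(N + 1 : ℝ) * poissonWeight (N + 1) (N + 1) := by
    rw [sqrt_mul_poissonWeight_self, sqrt_mul_poissonWeight_self]
    gcongr
  push_cast
  rw [Real.sqrt_div (by positivity), div_mul_eq_mul_div, le_div_iff₀' (by positivity)]
  exact h

lemma poissonWeight_sub_le_poissonWeight_four_mul {m y : ℕ} (hm : 1 ≤ m) (hy : y ≤ m) :
    poissonWeight m (m - y)
      ≤ 2 * Real.exp (-(y * (y - 1) / (4 * m))) * poissonWeight (4 * m : ℕ) (4 * m - y) := by
  have hm0 : (0 : ℝ) < m := by positivity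
  have hsqrt : √((4 * m : ℕ) / m : ℝ) = 2 := by
    rw [Nat.cast_mul, mul_div_cancel_right₀ _ hm0.ne', Nat.cast_ofNat,
      show (4 : ℝ) = 2 ^ 2 by norm_num, Real.sqrt_sq zero_le_two]
  have hself : poissonWeight m m ≤ 2 * poissonWeight (4 * m : ℕ) (4 * m) :=
    hsqrt ▸ poissonWeight_self_le_sqrt_mul hm (by omega)
  have hexp : Real.exp (-(y * (y - 1) / (2 * m)))
      = Real.exp (-(y * (y - 1) / (4 * m))) * Real.exp (-(y * (y - 1) / (4 * m : ℕ))) := by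
    rw [← Real.exp_add]
    congr 1
    push_cast
    field_simp
    ring
  calc poissonWeight m (m - y)
      ≤ 2 * poissonWeight (4 * m : ℕ) (4 * m) * Real.exp (-(y * (y - 1) / (2 * m))) :=
        (poissonWeight_sub_le hy).trans (by gcongr)
    _ = 2 * Real.exp (-(y * (y - 1) / (4 * m)))
          * (poissonWeight (4 * m : ℕ) (4 * m) * Real.exp (-(y * (y - 1) / (4 * m : ℕ)))) := by
        rw [hexp]
        ring
    _ ≤ 2 * Real.exp (-(y * (y - 1) / (4 * m))) * poissonWeight (4 * m : ℕ) (4 * m - y) := by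
        gcongr
        exact le_poissonWeight_sub (by omega)

lemma poissonWeight_self_succ_le (m : ℕ) :
    poissonWeight (m + 1) (m + 1) ≤ poissonWeight m m := by
  have h : ((m : ℝ) + 1) ^ m ≤ m ^ m * Real.exp 1 := by
    rcases m.eq_zero_or_pos with rfl | hm
    · simp
    · calc ((m : ℝ) + 1) ^ m = m ^ m * (1 / m + 1) ^ m := by
            rw [← mul_pow, mul_add, mul_one_div_cancel (by positivity), mul_one, add_comm]
        _ ≤ m ^ m * Real.exp (1 / m) ^ m := by gcongr; exact Real.add_one_le_exp _
        _ = m ^ m * Real.exp 1 := by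
            rw [← Real.exp_nat_mul]
            field_simp
  have hsucc := succ_mul_poissonWeight_succ (m + 1) m
  rw [mul_right_inj' (by positivity)] at hsucc
  calc poissonWeight (m + 1) (m + 1)
      = Real.exp (-m) * Real.exp (-1) * (m + 1) ^ m / m ! := by
        rw [hsucc, poissonWeight, neg_add, Real.exp_add]
    _ ≤ Real.exp (-m) * Real.exp (-1) * (m ^ m * Real.exp 1) / m ! := by gcongr
    _ = poissonWeight m m := by
        rw [poissonWeight, Real.exp_neg 1]
        field_simp

end PoissonWeight

section HitProb

/-- The probability that the random walk with steps `X i - 1`, the `X i` being independent Poisson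
variables of parameter `1`, hits `-y` for the first time at time `m`. It is defined by Kemperman's
formula `y / m * P(S_m = -y)`. -/
noncomputable def hitProb : ℕ → ℕ → ℝ
  | 0, y => if y = 0 then 1 else 0
  | m + 1, y => if y ≤ m + 1 then y / (m + 1) * poissonWeight (m + 1) (m + 1 - y) else 0

lemma hitProb_eq_zero {m y : ℕ} (h : m < y) : hitProb m y = 0 := by
  cases m with
  | zero => exact if_neg (by omega)
  | succ m => exact if_neg (by omega)

lemma hitProb_zero_right {m : ℕ} (hm : m ≠ 0) : hitProb m 0 = 0 := by
  cases m with
  | zero => exact absurd rfl hm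
  | succ m => simp [hitProb]

lemma hitProb_eq {m y : ℕ} (hm : m ≠ 0) (hy : y ≤ m) :
    hitProb m y = y / m * poissonWeight m (m - y) := by
  cases m with
  | zero => exact absurd rfl hm
  | succ m => simp only [hitProb, if_pos hy, Nat.cast_succ]

lemma hitProb_nonneg (m y : ℕ) : 0 ≤ hitProb m y := by
  rcases lt_or_ge m y with hy | hy
  · exact (hitProb_eq_zero hy).ge
  rcases eq_or_ne m 0 with rfl | hm
  · rw [hitProb]; split_ifs <;> norm_num
  · rw [hitProb_eq hm hy]
    exact mul_nonneg (by positivity) (poissonWeight_nonneg (Nat.cast_nonneg m) _)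

lemma hitProb_one {m : ℕ} (hm : m ≠ 0) : hitProb m 1 = poissonWeight m m / m := by
  obtain ⟨m, rfl⟩ := Nat.exists_eq_succ_of_ne_zero hm
  have hsucc := succ_mul_poissonWeight_succ (m + 1) m
  rw [mul_right_inj' (by positivity)] at hsucc
  rw [hitProb_eq hm (by omega)]
  rw [Nat.cast_one, Nat.succ_sub_one, Nat.cast_succ, ← hsucc]
  ring

lemma hitProb_one_pos {m : ℕ} (hm : m ≠ 0) : 0 < hitProb m 1 := by
  rw [hitProb_one hm, poissonWeight]
  positivity

lemma hitProb_one_anti {m N : ℕ} (hm : m ≠ 0) (hN : m ≤ N) : hitProb N 1 ≤ hitProb m 1 := by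
  have hanti : Antitone fun m : ℕ => poissonWeight m m :=
    antitone_nat_of_succ_le fun m => by exact_mod_cast poissonWeight_self_succ_le m
  rw [hitProb_one hm, hitProb_one (by omega)]
  exact div_le_div₀ (poissonWeight_nonneg (Nat.cast_nonneg m) m) (hanti hN) (by positivity)
    (by exact_mod_cast hN)

lemma sum_antidiagonal_poissonWeight_mul_hitProb (y N : ℕ) :
    ∑ ij ∈ antidiagonal N, poissonWeight 1 ij.1 * hitProb (y + N) (y + ij.1)
      = hitProb (y + N + 1) (y + 1) := by
  rcases eq_or_ne (y + N) 0 with h0 | h0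
  · obtain ⟨rfl, rfl⟩ := Nat.add_eq_zero_iff.1 h0
    simp [hitProb, poissonWeight]
  set m := y + N with hm
  have hmy : (m : ℝ) = y + N := by exact_mod_cast hm
  have hterm : ∀ ij ∈ antidiagonal N, poissonWeight 1 ij.1 * hitProb m (y + ij.1)
      = poissonWeight 1 ij.1 * poissonWeight m ij.2
        - poissonWeight 1 ij.1 * (ij.2 * poissonWeight m ij.2) / m := by
    rintro ⟨i, j⟩ hij
    have hij : i + j = N := mem_antidiagonal.1 hij
    rw [hitProb_eq h0 (by omega), show m - (y + i) = j by omega,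
      show ((y + i : ℕ) : ℝ) = m - j by rw [hmy, ← hij]; push_cast; ring]
    field_simp
  have hbiased := add_mul_sum_antidiagonal_poissonWeight_mul 1 m N
  rw [mul_comm, ← eq_div_iff (by positivity)] at hbiased
  rw [sum_congr rfl hterm, sum_sub_distrib, ← sum_div, sum_antidiagonal_poissonWeight_mul, hbiased,
    hitProb_eq (by omega) (by omega), show m + 1 - (y + 1) = N by omega, Nat.cast_succ,
    Nat.cast_succ, add_comm (1 : ℝ), hmy]
  have : (y + N : ℝ) ≠ 0 := by exact_mod_cast h0
  field_simp
  ring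

lemma hasSum_poissonWeight_mul_hitProb (m y : ℕ) :
    HasSum (fun i => poissonWeight 1 i * hitProb m (y + i)) (hitProb (m + 1) (y + 1)) := by
  rcases lt_or_ge m y with hy | hy
  · simp only [hitProb_eq_zero (by omega : m + 1 < y + 1),
      fun i => hitProb_eq_zero (by omega : m < y + i), mul_zero, hasSum_zero]
  obtain ⟨N, rfl⟩ := Nat.exists_eq_add_of_le hy
  rw [← sum_antidiagonal_poissonWeight_mul_hitProb,
    Nat.sum_antidiagonal_eq_sum_range_succ_mk]
  refine hasSum_sum_of_ne_finset_zero fun i hi => ?_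
  rw [mem_range] at hi
  rw [hitProb_eq_zero (by omega), mul_zero]

lemma hitProb_succ_le_exp_mul_hitProb (m x : ℕ) :
    hitProb m (x + 1) ≤ 8 * Real.exp (-(x ^ 2 / (4 * m))) * hitProb (4 * m) (x + 1) := by
  rcases lt_or_ge m (x + 1) with hx | hx
  · rw [hitProb_eq_zero hx]
    exact mul_nonneg (by positivity) (hitProb_nonneg _ _)
  have hexp : Real.exp (-((x + 1 : ℕ) * ((x + 1 : ℕ) - 1) / (4 * m)))
      ≤ Real.exp (-(x ^ 2 / (4 * m))) := by
    rw [Nat.cast_succ, add_sub_cancel_right]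
    gcongr
    nlinarith
  have hpos := poissonWeight_nonneg (Nat.cast_nonneg (4 * m)) (4 * m - (x + 1))
  rw [hitProb_eq (by omega) hx, hitProb_eq (by omega) (by omega)]
  calc ((x + 1 : ℕ) : ℝ) / m * poissonWeight m (m - (x + 1))
      ≤ (x + 1 : ℕ) / m * (2 * Real.exp (-(x ^ 2 / (4 * m)))
          * poissonWeight (4 * m : ℕ) (4 * m - (x + 1))) := by
        gcongr
        exact (poissonWeight_sub_le_poissonWeight_four_mul (by omega) hx).trans (by gcongr)
    _ = 8 * Real.exp (-(x ^ 2 / (4 * m)))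
          * ((x + 1 : ℕ) / (4 * m : ℕ) * poissonWeight (4 * m : ℕ) (4 * m - (x + 1))) := by
        push_cast
        field_simp
        ring

lemma hitProb_succ_le_mul_hitProb_one {m N : ℕ} (hm : m ≠ 0) (hN : m ≤ N) (x : ℕ) :
    hitProb m (x + 1) ≤ (x + 1) * (N / m : ℝ) ^ (3 / 2 : ℝ) * hitProb N 1 := by
  rcases lt_or_ge m (x + 1) with hx | hx
  · rw [hitProb_eq_zero hx]
    exact mul_nonneg (by positivity) (hitProb_nonneg _ _)
  have hm0 : (0 : ℝ) < m := by positivity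
  have hN0 : (0 : ℝ) < N := hm0.trans_le (by exact_mod_cast hN)
  have hmode : poissonWeight m (m - (x + 1)) ≤ poissonWeight m m := by
    refine (poissonWeight_sub_le hx).trans (mul_le_of_le_one_right ?_ (Real.exp_le_one_iff.2 ?_))
    · exact poissonWeight_nonneg hm0.le m
    · rw [Nat.cast_succ, add_sub_cancel_right, neg_nonpos]
      positivity
  have hsqrt : (N / m : ℝ) ^ (3 / 2 : ℝ) = N / m * √(N / m) := by
    rw [Real.sqrt_eq_rpow, show (3 / 2 : ℝ) = 1 + 1 / 2 by norm_num,
      Real.rpow_one_add' (by positivity) (by norm_num)]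
  rw [hitProb_eq hm hx, hitProb_one (by omega), hsqrt]
  calc ((x + 1 : ℕ) : ℝ) / m * poissonWeight m (m - (x + 1))
      ≤ (x + 1 : ℕ) / m * (√(N / m : ℝ) * poissonWeight N N) := by
        gcongr
        exact hmode.trans (poissonWeight_self_le_sqrt_mul (by omega) hN)
    _ = (x + 1) * (N / m * √(N / m)) * (poissonWeight N N / N) := by
        push_cast
        field_simp

end HitProb

section ExpDiff

/-- The function `e^{sz} - e^{-2sz}`, which vanishes at `0` and, for `0 ≤ s ≤ 1`, is multiplied by
at most `e^{s²}` by the transition operator of the walk killed at `0`. It plays the role of a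
positive eigenfunction that grows exponentially at rate `s`. -/
noncomputable def expDiff (s : ℝ) (z : ℕ) : ℝ := Real.exp s ^ z - Real.exp (-(2 * s)) ^ z

lemma expDiff_nonneg {s : ℝ} (hs : 0 ≤ s) (z : ℕ) : 0 ≤ expDiff s z :=
  sub_nonneg.2 (by gcongr; linarith)

lemma sum_poissonWeight_mul_expDiff_le {s : ℝ} (h0 : 0 ≤ s) (h1 : s ≤ 1) (y N : ℕ) :
    ∑ i ∈ range N, poissonWeight 1 i * expDiff s (y + i)
      ≤ Real.exp (s ^ 2) * expDiff s (y + 1) := by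
  have hsum : ∀ u : ℝ, HasSum (fun i => poissonWeight 1 i * Real.exp u ^ (y + i))
      (Real.exp (Real.exp u - 1 - u) * Real.exp u ^ (y + 1)) := fun u => by
    have hexp : Real.exp (Real.exp u - 1 - u) * Real.exp u ^ (y + 1)
        = Real.exp u ^ y * Real.exp (1 * (Real.exp u - 1)) := by
      rw [Real.exp_sub _ u, pow_succ, one_mul]
      field_simp
    rw [hexp]
    exact ((hasSum_poissonWeight_mul_pow 1 (Real.exp u)).mul_left _).congr_fun fun i => by ring
  have hcompare : Real.exp s - 1 - s ≤ Real.exp (-(2 * s)) - 1 - -(2 * s) := by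
    linarith [exp_sub_exp_neg_two_mul_le h0 h1]
  have hexp : Real.exp s - 1 - s ≤ s ^ 2 :=
    (abs_le.1 (Real.abs_exp_sub_one_sub_id_le (abs_le.2 ⟨by linarith, h1⟩))).2
  calc ∑ i ∈ range N, poissonWeight 1 i * expDiff s (y + i)
      ≤ Real.exp (Real.exp s - 1 - s) * Real.exp s ^ (y + 1)
          - Real.exp (Real.exp (-(2 * s)) - 1 - -(2 * s)) * Real.exp (-(2 * s)) ^ (y + 1) := by
        refine sum_le_hasSum _ (fun i _ => ?_)
          (((hsum s).sub (hsum (-(2 * s)))).congr_fun fun i => mul_sub _ _ _)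
        exact mul_nonneg (poissonWeight_nonneg zero_le_one i) (expDiff_nonneg h0 _)
    _ ≤ Real.exp (Real.exp s - 1 - s) * expDiff s (y + 1) := by
        rw [expDiff, mul_sub]
        gcongr
    _ ≤ Real.exp (s ^ 2) * expDiff s (y + 1) := by
        gcongr
        exact expDiff_nonneg h0 _

lemma mul_exp_le_expDiff {s : ℝ} (hs : 0 < s) (z : ℕ) :
    z * Real.exp (s * z / 2) ≤ 2 / s * expDiff s z := by
  set w := s * z / 2 with hw
  have hw0 : 0 ≤ w := by positivity
  have hpow : Real.exp s ^ z = Real.exp w * Real.exp w := by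
    rw [← Real.exp_nat_mul, ← Real.exp_add, hw]
    ring_nf
  have hone : Real.exp (-(2 * s)) ^ z ≤ 1 :=
    pow_le_one₀ (Real.exp_pos _).le (Real.exp_le_one_iff.2 (by linarith))
  have hdiff : w * Real.exp w ≤ expDiff s z := by
    rw [expDiff, hpow]
    nlinarith [Real.add_one_le_exp w]
  calc z * Real.exp w = 2 / s * (w * Real.exp w) := by
        rw [hw]
        field_simp
    _ ≤ 2 / s * expDiff s z := by gcongr

end ExpDiff

section Walk

variable {Ω : Type*}

lemma walk_zero (X : ℕ → Ω → ℕ) (ω : Ω) : walk X 0 ω = 0 := by simp [walk]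

lemma walk_succ (X : ℕ → Ω → ℕ) (k : ℕ) (ω : Ω) :
    walk X (k + 1) ω = walk X k ω + X k ω - 1 := by
  rw [walk, sum_range_succ, walk, add_sub_assoc]

lemma walk_nonneg_of_forall_ne {X : ℕ → Ω → ℕ} {k : ℕ} {ω : Ω}
    (h : ∀ j ≤ k, walk X j ω ≠ -1) : 0 ≤ walk X k ω := by
  induction k with
  | zero => exact (walk_zero X ω).ge
  | succ k ih =>
    have hk := ih fun j hj => h j (by omega)
    have hsucc := h (k + 1) le_rfl
    rw [walk_succ] at hsucc ⊢
    omega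

lemma walk_le_walk_add (X : ℕ → Ω → ℕ) (k m : ℕ) (ω : Ω) :
    walk X k ω ≤ walk X (k + m) ω + m := by
  induction m with
  | zero => simp
  | succ m ih =>
    rw [← add_assoc, walk_succ]
    push_cast
    omega

/-- The event that the walk is at `x` at time `k` and has not visited `-1` before. Every moment of
an excursion is a sum over these events, and `aliveAt X (n + 1) (-1)` is the excursion event
itself. -/
def aliveAt (X : ℕ → Ω → ℕ) (k : ℕ) (x : ℤ) : Set Ω :=
  {ω | walk X k ω = x ∧ ∀ j < k, walk X j ω ≠ -1}

lemma excursion_eq_aliveAt (X : ℕ → Ω → ℕ) (n : ℕ) :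
    excursion X n = aliveAt X (n + 1) (-1) := by
  ext ω
  have hle : ∀ i : ℕ, hitTime X (-1) ω ≤ i ↔ ∃ j ∈ Set.Icc 1 i, walk X j ω = -1 :=
    fun i => hittingAfter_le_iff
  constructor
  · intro (h : hitTime X (-1) ω = (n + 1 : ℕ))
    obtain ⟨j, ⟨hj1, hjn⟩, hj⟩ := (hle (n + 1)).1 h.le
    have hne : ∀ i < n + 1, walk X i ω ≠ -1 := fun i hi hwalk => by
      rcases i.eq_zero_or_pos with rfl | hi0
      · simp [walk_zero] at hwalk
      · have := h ▸ (hle i).2 ⟨i, ⟨hi0, le_rfl⟩, hwalk⟩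
        exact hi.not_ge (by exact_mod_cast this)
    obtain rfl : j = n + 1 := le_antisymm hjn (not_lt.1 fun hlt => hne j hlt hj)
    exact ⟨hj, hne⟩
  · rintro ⟨hwalk, hne⟩
    refine le_antisymm ((hle (n + 1)).2 ⟨n + 1, ⟨by omega, le_rfl⟩, hwalk⟩) (not_lt.1 fun hlt => ?_)
    obtain ⟨i, hi⟩ := WithTop.ne_top_iff_exists.1 hlt.ne_top
    rw [← hi] at hlt
    obtain ⟨j, ⟨-, hji⟩, hj⟩ := (hle i).1 hi.ge
    exact hne j (hji.trans_lt (WithTop.coe_lt_coe.1 hlt)) hj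

lemma pairwise_disjoint_aliveAt (X : ℕ → Ω → ℕ) (k : ℕ) :
    Pairwise (Function.onFun Disjoint (aliveAt X k)) := fun _ _ hxy =>
  Set.disjoint_left.2 fun _ hx hy => hxy (hx.1.symm.trans hy.1)

lemma aliveAt_zero_zero (X : ℕ → Ω → ℕ) : aliveAt X 0 0 = Set.univ := by
  ext ω; simp [aliveAt, walk_zero]

lemma aliveAt_zero_of_ne (X : ℕ → Ω → ℕ) {x : ℤ} (hx : x ≠ 0) : aliveAt X 0 x = ∅ := by
  ext ω; simp [aliveAt, walk_zero, hx.symm]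

lemma aliveAt_inter_preimage_subset (X : ℕ → Ω → ℕ) (k x i : ℕ) :
    aliveAt X k x ∩ X k ⁻¹' {i} ⊆ aliveAt X (k + 1) (x + i - 1) := by
  rintro ω ⟨⟨hwalk, hne⟩, rfl⟩
  refine ⟨by rw [walk_succ, hwalk], fun j hj => ?_⟩
  rcases Nat.lt_succ_iff_lt_or_eq.1 hj with hj | rfl
  · exact hne j hj
  · omega

lemma aliveAt_succ (X : ℕ → Ω → ℕ) (k x : ℕ) :
    aliveAt X (k + 1) x
      = ⋃ ij ∈ antidiagonal (x + 1), aliveAt X k ij.1 ∩ X k ⁻¹' {ij.2} := by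
  refine Set.Subset.antisymm (fun ω hω => ?_) (Set.iUnion₂_subset fun ij hij => ?_)
  · obtain ⟨hwalk, hne⟩ := hω
    obtain ⟨a, ha⟩ := Int.eq_ofNat_of_zero_le
      (walk_nonneg_of_forall_ne fun j (hj : j ≤ k) => hne j (by omega))
    rw [walk_succ, ha] at hwalk
    refine Set.mem_iUnion₂.2 ⟨(a, X k ω), mem_antidiagonal.2 (by dsimp only; omega), ?_⟩
    exact ⟨⟨ha, fun j hj => hne j (by omega)⟩, rfl⟩
  · have hsum := mem_antidiagonal.1 hij
    rw [show (x : ℤ) = ij.1 + ij.2 - 1 by omega]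
    exact aliveAt_inter_preimage_subset X k ij.1 ij.2

lemma exists_walk_eq_of_mem_excursion {X : ℕ → Ω → ℕ} {n k : ℕ} (hk : k ≤ n) {ω : Ω}
    (hω : ω ∈ excursion X n) : ∃ x ∈ range (n + 1), (x : ℤ) = walk X k ω := by
  rw [excursion_eq_aliveAt] at hω
  have hnonneg := walk_nonneg_of_forall_ne fun j (hj : j ≤ k) => hω.2 j (by omega)
  have hle := walk_le_walk_add X k (n + 1 - k) ω
  rw [show k + (n + 1 - k) = n + 1 by omega, hω.1] at hle
  obtain ⟨x, hx⟩ := Int.eq_ofNat_of_zero_le hnonneg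
  exact ⟨x, mem_range.2 (by omega), hx.symm⟩

lemma excursion_inter_walk_preimage {n k : ℕ} (X : ℕ → Ω → ℕ) (hk : k ≤ n) (x : ℤ) :
    excursion X n ∩ walk X k ⁻¹' {x} = aliveAt X k x ∩ aliveAt X (n + 1) (-1) := by
  rw [excursion_eq_aliveAt]
  ext ω
  constructor
  · rintro ⟨hω, hx⟩
    exact ⟨⟨hx, fun j hj => hω.2 j (by omega)⟩, hω⟩
  · rintro ⟨⟨hx, -⟩, hω⟩
    exact ⟨hω, hx⟩

/-- The `σ`-algebra generated by the first `k` steps, with respect to which the Markov property is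
stated. -/
@[reducible] def past (X : ℕ → Ω → ℕ) (k : ℕ) : MeasurableSpace Ω :=
  ⨆ i ∈ Set.Iio k, MeasurableSpace.comap (X i) ⊤

lemma past_mono (X : ℕ → Ω → ℕ) {k l : ℕ} (h : k ≤ l) : past X k ≤ past X l :=
  biSup_mono (Set.Iio_subset_Iio h)

lemma measurable_past (X : ℕ → Ω → ℕ) {i k : ℕ} (h : i < k) : Measurable[past X k] (X i) :=
  (comap_measurable (X i)).mono
    (le_biSup (fun i => MeasurableSpace.comap (X i) ⊤) (Set.mem_Iio.2 h)) le_rfl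

lemma measurable_walk_past (X : ℕ → Ω → ℕ) {j k : ℕ} (h : j ≤ k) :
    Measurable[past X k] (walk X j) :=
  @Finset.measurable_fun_sum _ _ _ _ _ _ (past X k) _ _ fun _ hi =>
    (measurable_from_top (f := fun n : ℕ => (n : ℤ) - 1)).comp
      (measurable_past X ((mem_range.1 hi).trans_le h))

lemma measurableSet_aliveAt_past (X : ℕ → Ω → ℕ) (k : ℕ) (x : ℤ) :
    MeasurableSet[past X k] (aliveAt X k x) := by
  have hinter : aliveAt X k x = walk X k ⁻¹' {x} ∩ ⋂ j ∈ Set.Iio k, walk X j ⁻¹' {-1}ᶜ := by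
    ext ω; simp [aliveAt]
  rw [hinter]
  exact (measurable_walk_past X le_rfl (measurableSet_singleton x)).inter <|
    MeasurableSet.biInter (Set.to_countable _) fun j hj =>
      measurable_walk_past X (le_of_lt hj) (measurableSet_singleton _).compl

variable [MeasurableSpace Ω] {P : Measure Ω} {X : ℕ → Ω → ℕ}

lemma past_le (hX : ∀ i, Measurable (X i)) (k : ℕ) : past X k ≤ ‹MeasurableSpace Ω› :=
  iSup₂_le fun i _ => (hX i).comap_le

lemma measurableSet_aliveAt (hX : ∀ i, Measurable (X i)) (k : ℕ) (x : ℤ) :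
    MeasurableSet (aliveAt X k x) :=
  past_le hX k _ (measurableSet_aliveAt_past X k x)

lemma measurable_walk (hX : ∀ i, Measurable (X i)) (k : ℕ) : Measurable (walk X k) :=
  (measurable_walk_past X le_rfl).mono (past_le hX k) le_rfl

instance (n : ℕ) : IsFiniteMeasure (excursionMeasure P X n) := by
  unfold excursionMeasure; infer_instance

lemma measurableSet_excursion (hX : ∀ i, Measurable (X i)) (n : ℕ) :
    MeasurableSet (excursion X n) :=
  excursion_eq_aliveAt X n ▸ measurableSet_aliveAt hX _ _

lemma ae_excursionMeasure_walk_mem (hX : ∀ i, Measurable (X i)) {n k : ℕ} (hk : k ≤ n) :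
    ∀ᵐ ω ∂excursionMeasure P X n, walk X k ω ∈ (range (n + 1)).map Nat.castEmbedding :=
  ae_cond_of_forall_mem (measurableSet_excursion hX n)
    fun _ hω => mem_map.2 (exists_walk_eq_of_mem_excursion hk hω)

lemma integrable_rpow_walk (hX : ∀ i, Measurable (X i)) {n k : ℕ} (hk : k ≤ n) (d : ℝ) :
    Integrable (fun ω => (walk X k ω : ℝ) ^ d) (excursionMeasure P X n) :=
  (integrable_map_of_ae_mem_finset (measurable_walk hX k) (ae_excursionMeasure_walk_mem hX hk)
    fun x => (x : ℝ) ^ d).comp_measurable (measurable_walk hX k)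

end Walk

/-- The assumption that the `X i` are independent Poisson variables of parameter `1` under `P`, so
that `walk X` is the random walk of the theorem. -/
structure IsPoissonSequence {Ω : Type*} [MeasurableSpace Ω] (P : Measure Ω) (X : ℕ → Ω → ℕ) :
    Prop where
  measurable : ∀ i, Measurable (X i)
  iIndepFun : iIndepFun X P
  map_eq : ∀ i, P.map (X i) = poissonMeasure 1

namespace IsPoissonSequence

variable {Ω : Type*} [MeasurableSpace Ω] {P : Measure Ω} {X : ℕ → Ω → ℕ}

lemma measureReal_preimage (hX : IsPoissonSequence P X) (k i : ℕ) :
    P.real (X k ⁻¹' {i}) = poissonWeight 1 i := by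
  rw [← map_measureReal_apply (hX.measurable k) (measurableSet_singleton i), hX.map_eq,
    poissonMeasure_real_singleton, poissonWeight, NNReal.coe_one]

lemma measureReal_inter_preimage (hX : IsPoissonSequence P X) {k : ℕ} {B : Set Ω}
    (hB : MeasurableSet[past X k] B) (i : ℕ) :
    P.real (B ∩ X k ⁻¹' {i}) = P.real B * poissonWeight 1 i := by
  have hindep : Indep (past X k) (⨆ j ∈ ({k} : Set ℕ), MeasurableSpace.comap (X j) ⊤) P :=
    indep_iSup_of_disjoint (fun j => (hX.measurable j).comap_le) hX.iIndepFun (by simp)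
  have hstep : MeasurableSet[⨆ j ∈ ({k} : Set ℕ), MeasurableSpace.comap (X j) ⊤]
      (X k ⁻¹' {i}) := by
    rw [_root_.iSup_singleton]
    exact ⟨{i}, trivial, rfl⟩
  rw [measureReal_def, (Indep_iff _ _ _).1 hindep _ _ hB hstep, ENNReal.toReal_mul,
    ← measureReal_def, ← measureReal_def, hX.measureReal_preimage]

variable [IsProbabilityMeasure P]

lemma measureReal_aliveAt_succ (hX : IsPoissonSequence P X) (k x : ℕ) :
    P.real (aliveAt X (k + 1) x)
      = ∑ ij ∈ antidiagonal (x + 1), P.real (aliveAt X k ij.1) * poissonWeight 1 ij.2 := by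
  rw [aliveAt_succ, measureReal_biUnion_finset]
  · exact sum_congr rfl fun ij _ =>
      hX.measureReal_inter_preimage (measurableSet_aliveAt_past X k _) _
  · rintro ⟨a, i⟩ - ⟨b, j⟩ - hne
    refine Set.disjoint_left.2 ?_
    rintro ω ⟨⟨ha, -⟩, rfl⟩ ⟨⟨hb, -⟩, rfl⟩
    exact hne (by simpa using ha.symm.trans hb)
  · exact fun ij _ => (measurableSet_aliveAt hX.measurable k _).inter
      (hX.measurable k (measurableSet_singleton _))

-- The Markov property at time `k`: allowing any past event `B` lets the induction on `m` absorb the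
-- next step into `B`.
lemma measureReal_inter_aliveAt_neg_one (hX : IsPoissonSequence P X) (m : ℕ) {k y : ℕ} {B : Set Ω}
    (hB : MeasurableSet[past X k] B) (hBy : B ⊆ aliveAt X k (y - 1)) :
    P.real (B ∩ aliveAt X (k + m) (-1)) = P.real B * hitProb m y := by
  induction m generalizing k y B with
  | zero =>
    rcases y.eq_zero_or_pos with rfl | hy
    · rw [Set.inter_eq_left.2 (by simpa using hBy)]
      simp [hitProb]
    · have hdisj := pairwise_disjoint_aliveAt X k (i := y - 1) (j := -1) (by omega)
      rw [hitProb_eq_zero hy, mul_zero, add_zero, (hdisj.mono_left hBy).inter_eq,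
        measureReal_empty]
  | succ m ih =>
    rcases y with _ | y
    · have hdisj : Disjoint B (aliveAt X (k + (m + 1)) (-1)) := Set.disjoint_left.2
        fun ω hω hhit => hhit.2 k (by omega) (by simpa using (hBy hω).1)
      rw [hitProb_zero_right (by omega), mul_zero, hdisj.inter_eq, measureReal_empty]
    · refine (hasSum_measureReal_inter_preimage (hX.measurable k) _).unique
        (((hasSum_poissonWeight_mul_hitProb m y).mul_left (P.real B)).congr_fun fun i => ?_)
      have hBi : B ∩ X k ⁻¹' {i} ⊆ aliveAt X (k + 1) ((y + i : ℕ) - 1) := by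
        refine (Set.inter_subset_inter_left _ hBy).trans ?_
        simpa using aliveAt_inter_preimage_subset X k y i
      rw [Set.inter_right_comm, ← mul_assoc, ← hX.measureReal_inter_preimage hB,
        show k + (m + 1) = k + 1 + m by omega]
      exact ih ((past_mono X k.le_succ _ hB).inter
        (measurable_past X k.lt_succ_self (measurableSet_singleton i))) hBi

lemma measureReal_aliveAt_inter (hX : IsPoissonSequence P X) (k m x : ℕ) :
    P.real (aliveAt X k x ∩ aliveAt X (k + m) (-1))
      = P.real (aliveAt X k x) * hitProb m (x + 1) :=
  hX.measureReal_inter_aliveAt_neg_one m (measurableSet_aliveAt_past X k x) (by simp)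

lemma measureReal_aliveAt_neg_one (hX : IsPoissonSequence P X) (N : ℕ) :
    P.real (aliveAt X N (-1)) = hitProb N 1 := by
  simpa [aliveAt_zero_zero] using hX.measureReal_aliveAt_inter 0 N 0

lemma sum_measureReal_aliveAt_mul_hitProb_le (hX : IsPoissonSequence P X) (k m N : ℕ) :
    ∑ x ∈ range N, P.real (aliveAt X k x) * hitProb m (x + 1) ≤ hitProb (k + m) 1 := by
  simp only [← hX.measureReal_aliveAt_inter]
  rw [← measureReal_biUnion_finset, ← hX.measureReal_aliveAt_neg_one]
  · exact measureReal_mono (Set.iUnion₂_subset fun _ _ => Set.inter_subset_right)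
  · exact fun x _ y _ hxy => (pairwise_disjoint_aliveAt X k (Nat.cast_injective.ne hxy)).mono
      Set.inter_subset_left Set.inter_subset_left
  · exact fun x _ => (measurableSet_aliveAt hX.measurable _ _).inter
      (measurableSet_aliveAt hX.measurable _ _)

lemma measureReal_excursion (hX : IsPoissonSequence P X) (n : ℕ) :
    P.real (excursion X n) = hitProb (n + 1) 1 := by
  rw [excursion_eq_aliveAt, hX.measureReal_aliveAt_neg_one]

lemma measure_excursion_pos (hX : IsPoissonSequence P X) (n : ℕ) : 0 < P (excursion X n) := by
  have hpos := hitProb_one_pos n.succ_ne_zero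
  rw [← hX.measureReal_excursion] at hpos
  exact (ENNReal.toReal_pos_iff.1 hpos).1

lemma excursionMeasure_real_walk_preimage (hX : IsPoissonSequence P X) {n k : ℕ} (hk : k ≤ n)
    (x : ℕ) : (excursionMeasure P X n).real (walk X k ⁻¹' {(x : ℤ)})
      = P.real (aliveAt X k x) * hitProb (n + 1 - k) (x + 1) / hitProb (n + 1) 1 := by
  have hinter := hX.measureReal_aliveAt_inter k (n + 1 - k) x
  rw [show k + (n + 1 - k) = n + 1 by omega] at hinter
  rw [excursionMeasure, measureReal_def, cond_apply (measurableSet_excursion hX.measurable n),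
    ENNReal.toReal_mul, ENNReal.toReal_inv, ← measureReal_def, ← measureReal_def,
    hX.measureReal_excursion, excursion_inter_walk_preimage X hk, hinter, inv_mul_eq_div]

lemma excursionMoment_eq_sum (hX : IsPoissonSequence P X) {n k : ℕ} (hk : k ≤ n) (d : ℝ) :
    excursionMoment P X n k d
      = (∑ x ∈ range (n + 1),
          (x : ℝ) ^ d * (P.real (aliveAt X k x) * hitProb (n + 1 - k) (x + 1)))
        / hitProb (n + 1) 1 := by
  rw [excursionMoment, integral_comp_of_ae_mem_finset (measurable_walk hX.measurable k)
    (ae_excursionMeasure_walk_mem hX.measurable hk) fun x => (x : ℝ) ^ d, sum_map, sum_div]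
  refine sum_congr rfl fun x _ => ?_
  rw [Nat.castEmbedding_apply, hX.excursionMeasure_real_walk_preimage hk, Int.cast_natCast]
  ring

lemma sum_measureReal_aliveAt_mul_le (hX : IsPoissonSequence P X) {h : ℕ → ℝ} {c : ℝ}
    (hh : ∀ y, 0 ≤ h y) (hc : 0 ≤ c)
    (hstep : ∀ y N, ∑ i ∈ range N, poissonWeight 1 i * h (y + i) ≤ c * h (y + 1)) (k N : ℕ) :
    ∑ x ∈ range N, P.real (aliveAt X k x) * h (x + 1) ≤ c ^ k * h 1 := by
  induction k generalizing N with
  | zero =>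
    cases N with
    | zero => simpa using hh 1
    | succ N =>
      have hempty : ∀ x : ℕ, aliveAt X 0 (x + 1 : ℕ) = ∅ := fun x =>
        aliveAt_zero_of_ne X (by omega)
      simp only [sum_range_succ', hempty, measureReal_empty, zero_mul, sum_const_zero, zero_add,
        Nat.cast_zero, aliveAt_zero_zero, probReal_univ, one_mul, pow_zero, le_refl]
  | succ k ih =>
    calc ∑ x ∈ range N, P.real (aliveAt X (k + 1) x) * h (x + 1)
        = ∑ x ∈ range N, ∑ ij ∈ antidiagonal (x + 1),
            P.real (aliveAt X k ij.1) * (poissonWeight 1 ij.2 * h (ij.1 + ij.2)) := by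
          refine sum_congr rfl fun x _ => ?_
          rw [hX.measureReal_aliveAt_succ, sum_mul]
          exact sum_congr rfl fun ij hij => by rw [mem_antidiagonal.1 hij, mul_assoc]
      _ ≤ ∑ a ∈ range (N + 1), ∑ i ∈ range (N + 1),
            P.real (aliveAt X k a) * (poissonWeight 1 i * h (a + i)) :=
          sum_range_sum_antidiagonal_succ_le (fun ij => mul_nonneg measureReal_nonneg
            (mul_nonneg (poissonWeight_nonneg zero_le_one _) (hh _))) N
      _ ≤ ∑ a ∈ range (N + 1), P.real (aliveAt X k a) * (c * h (a + 1)) := by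
          simp only [← mul_sum]
          gcongr with a
          exact hstep a (N + 1)
      _ = c * ∑ a ∈ range (N + 1), P.real (aliveAt X k a) * h (a + 1) := by
          rw [mul_sum]
          exact sum_congr rfl fun a _ => mul_left_comm _ _ _
      _ ≤ c ^ (k + 1) * h 1 := by
          rw [pow_succ', mul_assoc]
          gcongr
          exact ih (N + 1)

lemma sum_measureReal_aliveAt_mul_exp_le (hX : IsPoissonSequence P X) {s : ℝ} (hs0 : 0 < s)
    (hs1 : s ≤ 1) (k N : ℕ) :
    ∑ x ∈ range N, P.real (aliveAt X k x) * ((x + 1 : ℕ) * Real.exp (s * (x + 1 : ℕ) / 2))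
      ≤ 6 * Real.exp (k * s ^ 2) := by
  have hone : expDiff s 1 ≤ 3 * s := by
    simpa only [expDiff, pow_one] using exp_sub_exp_neg_two_mul_le hs0.le hs1
  calc ∑ x ∈ range N, P.real (aliveAt X k x) * ((x + 1 : ℕ) * Real.exp (s * (x + 1 : ℕ) / 2))
      ≤ ∑ x ∈ range N, P.real (aliveAt X k x) * (2 / s * expDiff s (x + 1)) :=
        sum_le_sum fun x _ =>
          mul_le_mul_of_nonneg_left (mul_exp_le_expDiff hs0 (x + 1)) measureReal_nonneg
    _ = 2 / s * ∑ x ∈ range N, P.real (aliveAt X k x) * expDiff s (x + 1) := by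
        rw [mul_sum]
        exact sum_congr rfl fun x _ => mul_left_comm _ _ _
    _ ≤ 2 / s * (Real.exp (s ^ 2) ^ k * (3 * s)) := by
        gcongr
        refine (hX.sum_measureReal_aliveAt_mul_le (expDiff_nonneg hs0.le) (Real.exp_pos _).le
          (sum_poissonWeight_mul_expDiff_le hs0.le hs1) k N).trans (by gcongr)
    _ = 6 * Real.exp (k * s ^ 2) := by
        rw [← Real.exp_nat_mul]
        field_simp
        norm_num

lemma excursionMoment_le_gaussian (hX : IsPoissonSequence P X) {n k : ℕ} (hk : k ≤ n) {d : ℝ}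
    (hd : 0 < d) : excursionMoment P X n k d ≤ 8 * (2 * d * (n + 1 - k : ℕ)) ^ (d / 2) := by
  set m := n + 1 - k
  have hm0 : (0 : ℝ) < m := by exact_mod_cast (by omega : 0 < m)
  have hterm : ∀ x : ℕ, (x : ℝ) ^ d * hitProb m (x + 1)
      ≤ 8 * (2 * d * m) ^ (d / 2) * hitProb (4 * m) (x + 1) := fun x => by
    have hpow := rpow_le_mul_exp_sq x.cast_nonneg hd (c := 1 / (4 * m)) (by positivity)
    rw [show d / (2 * (1 / (4 * m))) = 2 * d * m by field_simp; ring, one_div_mul_eq_div] at hpow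
    calc (x : ℝ) ^ d * hitProb m (x + 1)
        ≤ (2 * d * m) ^ (d / 2) * Real.exp (x ^ 2 / (4 * m))
            * (8 * Real.exp (-(x ^ 2 / (4 * m))) * hitProb (4 * m) (x + 1)) :=
          mul_le_mul hpow (hitProb_succ_le_exp_mul_hitProb m x) (hitProb_nonneg _ _) (by positivity)
      _ = 8 * (2 * d * m) ^ (d / 2) * hitProb (4 * m) (x + 1) := by
          rw [Real.exp_neg]
          field_simp
  rw [hX.excursionMoment_eq_sum hk, div_le_iff₀ (hitProb_one_pos n.succ_ne_zero)]
  calc ∑ x ∈ range (n + 1), (x : ℝ) ^ d * (P.real (aliveAt X k x) * hitProb m (x + 1))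
      ≤ ∑ x ∈ range (n + 1), 8 * (2 * d * m) ^ (d / 2)
          * (P.real (aliveAt X k x) * hitProb (4 * m) (x + 1)) := by
        refine sum_le_sum fun x _ => ?_
        rw [mul_left_comm, mul_left_comm _ (P.real _)]
        exact mul_le_mul_of_nonneg_left (hterm x) measureReal_nonneg
    _ = 8 * (2 * d * m) ^ (d / 2)
          * ∑ x ∈ range (n + 1), P.real (aliveAt X k x) * hitProb (4 * m) (x + 1) :=
        (mul_sum _ _ _).symm
    _ ≤ 8 * (2 * d * m) ^ (d / 2) * hitProb (n + 1) 1 := by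
        gcongr
        exact (hX.sum_measureReal_aliveAt_mul_hitProb_le k (4 * m) (n + 1)).trans
          (hitProb_one_anti n.succ_ne_zero (by omega))

lemma excursionMoment_le_of_remaining_le (hX : IsPoissonSequence P X) {n k r : ℕ} (hk : k ≤ n)
    (hr : n + 1 - k ≤ 2 * r) {d : ℝ} (hd : 1 ≤ d) :
    excursionMoment P X n k d ≤ (256 * d * r) ^ (d / 2) := by
  have hr' : ((n + 1 - k : ℕ) : ℝ) ≤ 2 * r := by exact_mod_cast hr
  calc excursionMoment P X n k d ≤ 8 * (2 * d * (n + 1 - k : ℕ)) ^ (d / 2) :=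
        hX.excursionMoment_le_gaussian hk (by linarith)
    _ ≤ 8 * (2 * d * (2 * r)) ^ (d / 2) := by gcongr
    _ ≤ (8 ^ 2 * (2 * d * (2 * r))) ^ (d / 2) :=
        mul_rpow_half_le (by norm_num) (by positivity) hd
    _ = (256 * d * r) ^ (d / 2) := by ring_nf

lemma excursionMoment_le_exponential (hX : IsPoissonSequence P X) {n k : ℕ} (hk : k ≤ n)
    {s d : ℝ} (hs0 : 0 < s) (hs1 : s ≤ 1) (hd : 0 < d) :
    excursionMoment P X n k d ≤ ((n + 1 : ℕ) / (n + 1 - k : ℕ) : ℝ) ^ (3 / 2 : ℝ)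
      * (6 * Real.exp (k * s ^ 2) * (2 * d / s) ^ d) := by
  set A : ℝ := ((n + 1 : ℕ) / (n + 1 - k : ℕ) : ℝ) ^ (3 / 2 : ℝ)
  have hpos := hitProb_one_pos n.succ_ne_zero
  have hhit : ∀ x : ℕ, hitProb (n + 1 - k) (x + 1) ≤ (x + 1 : ℕ) * A * hitProb (n + 1) 1 :=
    fun x => by
      rw [Nat.cast_succ x]
      exact hitProb_succ_le_mul_hitProb_one (by omega) (Nat.sub_le _ _) x
  have hpow : ∀ x : ℕ, (x : ℝ) ^ d ≤ (2 * d / s) ^ d * Real.exp (s * (x + 1 : ℕ) / 2) :=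
    fun x => by
      have h := rpow_le_mul_exp x.cast_nonneg hd (half_pos hs0)
      rw [div_div_eq_mul_div, mul_comm d, div_mul_eq_mul_div] at h
      exact h.trans (by gcongr; exact x.le_succ)
  rw [hX.excursionMoment_eq_sum hk, div_le_iff₀ hpos]
  calc ∑ x ∈ range (n + 1), (x : ℝ) ^ d * (P.real (aliveAt X k x) * hitProb (n + 1 - k) (x + 1))
      ≤ ∑ x ∈ range (n + 1), (2 * d / s) ^ d * Real.exp (s * (x + 1 : ℕ) / 2)
          * (P.real (aliveAt X k x) * ((x + 1 : ℕ) * A * hitProb (n + 1) 1)) :=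
        sum_le_sum fun x _ => mul_le_mul (hpow x)
          (mul_le_mul_of_nonneg_left (hhit x) measureReal_nonneg)
          (mul_nonneg measureReal_nonneg (hitProb_nonneg _ _)) (by positivity)
    _ = A * (2 * d / s) ^ d * hitProb (n + 1) 1 * ∑ x ∈ range (n + 1),
          P.real (aliveAt X k x) * ((x + 1 : ℕ) * Real.exp (s * (x + 1 : ℕ) / 2)) := by
        rw [mul_sum]
        exact sum_congr rfl fun x _ => by ring
    _ ≤ A * (2 * d / s) ^ d * hitProb (n + 1) 1 * (6 * Real.exp (k * s ^ 2)) := by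
        gcongr
        exact hX.sum_measureReal_aliveAt_mul_exp_le hs0 hs1 k (n + 1)
    _ = A * (6 * Real.exp (k * s ^ 2) * (2 * d / s) ^ d) * hitProb (n + 1) 1 := by ring

lemma excursionMoment_le_sqrt (hX : IsPoissonSequence P X) {n k : ℕ} (hk : k ≠ 0) (hkn : k < n)
    {d : ℝ} (hd : 1 ≤ d) : excursionMoment P X n k d
      ≤ ((n : ℝ) / (n - k)) ^ (3 / 2 : ℝ) * (36 * d * √k) ^ d := by
  have hk1 : 1 ≤ √(k : ℝ) := Real.one_le_sqrt.2 (by exact_mod_cast Nat.one_le_iff_ne_zero.2 hk)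
  have hexp : Real.exp (k * (1 / √k) ^ 2) ≤ 3 := by
    rw [div_pow, one_pow, Real.sq_sqrt k.cast_nonneg, mul_one_div_cancel (by exact_mod_cast hk)]
    exact Real.exp_one_lt_three.le
  have hlt : (0 : ℝ) < n - k := sub_pos.2 (by exact_mod_cast hkn)
  have hratio : ((n + 1 : ℕ) / (n + 1 - k : ℕ) : ℝ) ≤ n / (n - k) := by
    rw [Nat.cast_sub (by omega), Nat.cast_succ, div_le_div_iff₀ (by linarith) hlt]
    nlinarith [(k.cast_nonneg : (0 : ℝ) ≤ k)]
  have h := hX.excursionMoment_le_exponential hkn.le (s := 1 / √k) (by positivity)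
    ((div_le_one (by positivity)).2 hk1) (zero_lt_one.trans_le hd)
  rw [div_div_eq_mul_div, div_one] at h
  refine h.trans ?_
  gcongr
  calc 6 * Real.exp (k * (1 / √k) ^ 2) * (2 * d * √k) ^ d ≤ 18 * (2 * d * √k) ^ d := by
        gcongr
        linarith
    _ ≤ (18 * (2 * d * √k)) ^ d := mul_rpow_le (by norm_num) (by positivity) hd
    _ = (36 * d * √k) ^ d := by ring_nf

end IsPoissonSequence

end PoissonExcursion

theorem proposition8 :
    ∃ C : ℝ, 0 < C ∧
      ∀ {Ω : Type*} [MeasurableSpace Ω] (P : Measure Ω) [IsProbabilityMeasure P]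
        (X : ℕ → Ω → ℕ),
        (∀ i, Measurable (X i)) → iIndepFun X P → (∀ i, P.map (X i) = poissonMeasure 1) →
        ∀ n : ℕ, 2 ≤ n →
          -- the conditioning is on an event of positive probability
          0 < P (excursion X n) ∧
          ∀ k : ℕ, 1 ≤ k → k ≤ n - 1 → ∀ d : ℝ, 1 ≤ d →
            -- the moments are finite
            Integrable (fun ω => (walk X k ω : ℝ) ^ d) (excursionMeasure P X n) ∧
            excursionMoment P X n k d ≤ (C * d * n) ^ (d / 2) ∧
            excursionMoment P X n (n - k) d ≤
              ((n : ℝ) / ((n : ℝ) - k)) ^ ((3 : ℝ) / 2) * (C * d * k) ^ (d / 2) ∧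
            excursionMoment P X n k d ≤
              ((n : ℝ) / ((n : ℝ) - k)) ^ ((3 : ℝ) / 2) * (C * d * √(k : ℝ)) ^ d := by
  refine ⟨256, by norm_num, fun {Ω} _ P _ X hmeas hindep hmap n _ => ?_⟩
  have hX : PoissonExcursion.IsPoissonSequence P X := ⟨hmeas, hindep, hmap⟩
  refine ⟨hX.measure_excursion_pos n, fun k hk hkn d hd => ?_⟩
  have hlt : (k : ℝ) < n := by exact_mod_cast (by omega : k < n)
  refine ⟨?_, ?_, ?_, ?_⟩
  · exact PoissonExcursion.integrable_rpow_walk hmeas (by omega) d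
  · exact hX.excursionMoment_le_of_remaining_le (by omega) (by omega) hd
  · have hratio : (1 : ℝ) ≤ n / (n - k) :=
      (one_le_div (by linarith)).2 (by linarith [(k.cast_nonneg : (0 : ℝ) ≤ k)])
    refine (hX.excursionMoment_le_of_remaining_le (r := k) (by omega) (by omega) hd).trans ?_
    exact le_mul_of_one_le_left (by positivity) (Real.one_le_rpow hratio (by norm_num))
  · refine (hX.excursionMoment_le_sqrt (by omega) (by omega) hd).trans ?_
    gcongr
    norm_num
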